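/- Let $r\ge 0$ and $m\ge 0$ be integers with $2m\le r$. Let $S^k(\mathbb{C}^2)$ denote the $k$-th symmetric power of the standard representation of $\mathfrak{sl}_2(\mathbb{C})$, and let $$f_m: S^2(S^r(\mathbb{C}^2))\longrightarrow S^{2r-4m}(\mathbb{C}^2)$$ be a projection, that is, a surjective $\mathfrak{sl}_2(\mathbb{C})$-linear map (such a map exists and is unique up to a nonzero scalar). Let $$M_m=\{x\in\mathbb{P}S^r(\mathbb{C}^2)\;|\;f_m(xx)=0\}\subseteq\mathbb{P}S^r(\mathbb{C}^2)=\mathbb{P}^r .$$ Then $\dim M_m<2m$, where $\dim$ is the (Krull) dimension in the Zariski topology and $\dim\emptyset=-\infty$. Moreover, if $m=0$, then $M_m=\emptyset$. -/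

import Mathlib

open scoped TensorProduct LinearAlgebra.Projectivization

namespace BinaryForms

noncomputable section

/-! ### The `sl₂(ℂ)`-modules `S^r(ℂ²)` and `S²(S^r(ℂ²))` -/

/-- The Lie algebra `sl₂(ℂ)` of complex `2 × 2` matrices of trace zero. -/
abbrev SL2 : Type := LieAlgebra.SpecialLinear.sl (Fin 2) ℂ

/-- The symmetric algebra `⨁ᵣ S^r(ℂ²)` of `ℂ²`, the variables being the standard basis of `ℂ²`. -/
abbrev Poly : Type := MvPolynomial (Fin 2) ℂ

/-- The derivation of the symmetric algebra of `ℂ²` extending the action of the matrix `A` on `ℂ²`,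
`A eⱼ = ∑ᵢ Aᵢⱼ eᵢ`. -/
def matDer (A : Matrix (Fin 2) (Fin 2) ℂ) : Derivation ℂ Poly Poly :=
  MvPolynomial.mkDerivation ℂ fun j => ∑ i, MvPolynomial.C (A i j) * MvPolynomial.X i

theorem matDer_X (A : Matrix (Fin 2) (Fin 2) ℂ) (j : Fin 2) :
    matDer A (MvPolynomial.X j) = ∑ i, MvPolynomial.C (A i j) * MvPolynomial.X i :=
  MvPolynomial.mkDerivation_X _ _ _

theorem matDer_apply (A : Matrix (Fin 2) (Fin 2) ℂ) (p : Poly) :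
    matDer A p = ∑ j, (∑ i, MvPolynomial.C (A i j) * MvPolynomial.X i) *
      MvPolynomial.pderiv j p := by
  have h : matDer A = ∑ j, (∑ i, MvPolynomial.C (A i j) * MvPolynomial.X i : Poly) •
      (MvPolynomial.pderiv j : Derivation ℂ Poly Poly) := by
    apply MvPolynomial.derivation_ext
    intro k
    rw [matDer_X]
    fin_cases k <;> simp [MvPolynomial.pderiv_X, Fin.sum_univ_two]
  rw [h]
  simp [Fin.sum_univ_two]

/-- The action of `sl₂(ℂ)` on the symmetric algebra of `ℂ²` by derivations. -/
def derHom : SL2 →ₗ⁅ℂ⁆ Derivation ℂ Poly Poly where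
  toFun A := matDer A.1
  map_add' A B := by
    apply MvPolynomial.derivation_ext
    intro j
    simp [matDer_X, Fin.sum_univ_two]
    ring
  map_smul' c A := by
    apply MvPolynomial.derivation_ext
    intro j
    simp [matDer_X, Fin.sum_univ_two, MvPolynomial.smul_eq_C_mul]
    ring
  map_lie' := by
    intro A B
    apply MvPolynomial.derivation_ext
    intro j
    rw [Derivation.commutator_apply]
    have h : ∀ i k, (⁅A, B⁆ : SL2).1 i k = (A.1 * B.1 - B.1 * A.1) i k := fun _ _ => rfl
    simp only [matDer_X, h]
    simp [matDer_X, Fin.sum_univ_two, Matrix.mul_apply, Derivation.leibniz]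
    ring

instance : LieRingModule SL2 Poly := LieRingModule.compLieHom Poly derHom

instance : LieModule ℂ SL2 Poly := LieModule.compLieHom Poly derHom

theorem lie_poly (A : SL2) (p : Poly) : ⁅A, p⁆ = matDer A.1 p := rfl

/-- The `sl₂(ℂ)`-module `S^r(ℂ²)` of homogeneous polynomials of degree `r` in two variables. -/
def S (r : ℕ) : LieSubmodule ℂ SL2 Poly where
  __ := MvPolynomial.homogeneousSubmodule (Fin 2) ℂ r
  lie_mem := by
    intro A p hp
    change (matDer A.1 p).IsHomogeneous r
    have hp : p.IsHomogeneous r := hp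
    rw [matDer_apply]
    refine MvPolynomial.IsHomogeneous.sum _ _ _ fun j _ => ?_
    rcases Nat.eq_zero_or_pos r with rfl | hr
    · have : MvPolynomial.pderiv j p = 0 := by
        rw [MvPolynomial.totalDegree_eq_zero_iff_eq_C.1
          (Nat.le_zero.1 hp.totalDegree_le), MvPolynomial.pderiv_C]
      rw [this, mul_zero]
      exact MvPolynomial.isHomogeneous_zero _ _ _
    · have h1 : (∑ i, MvPolynomial.C (A.1 i j) * MvPolynomial.X i : Poly).IsHomogeneous 1 :=
        MvPolynomial.IsHomogeneous.sum _ _ _ fun i _ => by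
          simpa using (MvPolynomial.isHomogeneous_C (Fin 2) (A.1 i j)).mul
            (MvPolynomial.isHomogeneous_X ℂ i)
      have h2 := h1.mul (hp.pderiv (i := j))
      rwa [show 1 + (r - 1) = r by omega] at h2

/-- The symmetric square `S²(V) = (V ⊗ V) / ⟨x ⊗ y - y ⊗ x⟩` of an `sl₂(ℂ)`-module. The linear span
of the elements `x ⊗ y - y ⊗ x` is stable under `sl₂(ℂ)`, hence equal to the submodule that they
generate. -/
abbrev SymSq (V : Type) [AddCommGroup V] [Module ℂ V] [LieRingModule SL2 V] [LieModule ℂ SL2 V] :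
    Type :=
  (V ⊗[ℂ] V) ⧸ LieSubmodule.lieSpan ℂ SL2 {t : V ⊗[ℂ] V | ∃ x y : V, t = x ⊗ₜ[ℂ] y - y ⊗ₜ[ℂ] x}

/-- The product `xy ∈ S²(V)` of two vectors `x, y ∈ V`. -/
def symMul {V : Type} [AddCommGroup V] [Module ℂ V] [LieRingModule SL2 V] [LieModule ℂ SL2 V]
    (x y : V) : SymSq V :=
  LieSubmodule.Quotient.mk (x ⊗ₜ[ℂ] y)

/-! ### Existence of the projections -/

/-- The Cayley operator `∂₀ ⊗ ∂₁ - ∂₁ ⊗ ∂₀`. -/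
def cayley : (Poly ⊗[ℂ] Poly) →ₗ[ℂ] (Poly ⊗[ℂ] Poly) :=
  TensorProduct.map (MvPolynomial.pderiv 0).toLinearMap (MvPolynomial.pderiv 1).toLinearMap -
    TensorProduct.map (MvPolynomial.pderiv 1).toLinearMap (MvPolynomial.pderiv 0).toLinearMap

theorem cayley_tmul (p q : Poly) : cayley (p ⊗ₜ q) =
    MvPolynomial.pderiv 0 p ⊗ₜ MvPolynomial.pderiv 1 q -
      MvPolynomial.pderiv 1 p ⊗ₜ MvPolynomial.pderiv 0 q := by
  simp [cayley]

/-- The `N`-th transvectant. -/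
def trans (N : ℕ) : (Poly ⊗[ℂ] Poly) →ₗ[ℂ] Poly :=
  LinearMap.mul' ℂ Poly ∘ₗ (cayley ^ N)

theorem trans_zero_tmul (p q : Poly) : trans 0 (p ⊗ₜ q) = p * q := by simp [trans]

theorem trans_succ (N : ℕ) (t : Poly ⊗[ℂ] Poly) : trans (N + 1) t = trans N (cayley t) := by
  simp [trans, pow_succ]

theorem pderiv_matDer (A : Matrix (Fin 2) (Fin 2) ℂ) (k : Fin 2) (p : Poly) :
    MvPolynomial.pderiv k (matDer A p) =
      matDer A (MvPolynomial.pderiv k p) + ∑ j, A k j • MvPolynomial.pderiv j p := by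
  have h : ⁅(MvPolynomial.pderiv k : Derivation ℂ Poly Poly), matDer A⁆ =
      ∑ j, A k j • (MvPolynomial.pderiv j : Derivation ℂ Poly Poly) := by
    apply MvPolynomial.derivation_ext
    intro i
    rw [Derivation.commutator_apply]
    fin_cases k <;> fin_cases i <;>
      simp [matDer_X, Fin.sum_univ_two, MvPolynomial.pderiv_X, MvPolynomial.smul_eq_C_mul]
  have := congrArg (fun D : Derivation ℂ Poly Poly => D p) h
  simp only [Derivation.commutator_apply] at this
  rw [sub_eq_iff_eq_add] at this
  rw [this, add_comm]
  simp [Fin.sum_univ_two]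

theorem cayley_lie (A : SL2) (t : Poly ⊗[ℂ] Poly) : cayley ⁅A, t⁆ = ⁅A, cayley t⁆ := by
  induction t with
  | zero => simp
  | add x y hx hy => simp [hx, hy]
  | tmul p q =>
    have htr : A.1 0 0 + A.1 1 1 = 0 := by
      have := A.2
      change Matrix.trace A.1 = 0 at this
      rwa [Matrix.trace_fin_two] at this
    have h1 : A.1 1 1 = - A.1 0 0 := by linear_combination htr
    simp only [TensorProduct.LieModule.lie_tmul_right, map_add, cayley_tmul, lie_poly, lie_sub,
      pderiv_matDer, Fin.sum_univ_two, TensorProduct.add_tmul, TensorProduct.tmul_add,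
      ← TensorProduct.smul_tmul', TensorProduct.tmul_smul, h1]
    module

theorem trans_lie (N : ℕ) (A : SL2) (t : Poly ⊗[ℂ] Poly) : trans N ⁅A, t⁆ = ⁅A, trans N t⁆ := by
  induction N generalizing t with
  | zero =>
    induction t with
    | zero => simp
    | add x y hx hy => simp [hx, hy]
    | tmul p q =>
      simp only [TensorProduct.LieModule.lie_tmul_right, map_add, trans_zero_tmul, lie_poly,
        Derivation.leibniz, smul_eq_mul]
      ring
  | succ N ih => rw [trans_succ, trans_succ, cayley_lie, ih]

theorem trans_mem (N a b : ℕ) (p q : Poly) (hp : p.IsHomogeneous (a + N))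
    (hq : q.IsHomogeneous (b + N)) : (trans N (p ⊗ₜ q)).IsHomogeneous (a + b) := by
  induction N generalizing p q with
  | zero => rw [trans_zero_tmul]; exact hp.mul hq
  | succ N ih =>
    rw [trans_succ, cayley_tmul, map_sub]
    exact (ih _ _ hp.pderiv hq.pderiv).sub (ih _ _ hp.pderiv hq.pderiv)

theorem trans_swap (N : ℕ) (p q : Poly) : trans N (q ⊗ₜ p) = (-1) ^ N * trans N (p ⊗ₜ q) := by
  induction N generalizing p q with
  | zero => simp [trans_zero_tmul, mul_comm]
  | succ N ih =>
    rw [trans_succ, cayley_tmul, map_sub, ih, ih (MvPolynomial.pderiv 0 p), trans_succ, cayley_tmul,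
      map_sub]
    ring

theorem trans_value (N a b : ℕ) : ∃ c : ℂ, c ≠ 0 ∧
    trans N ((MvPolynomial.X 0 ^ (a + N)) ⊗ₜ
      (MvPolynomial.X 0 ^ b * MvPolynomial.X 1 ^ N)) = c • (MvPolynomial.X 0 ^ (a + b) : Poly) := by
  induction N with
  | zero => exact ⟨1, one_ne_zero, by simp [trans_zero_tmul, pow_add]⟩
  | succ N ih =>
    obtain ⟨c, hc, h⟩ := ih
    refine ⟨(a + N + 1 : ℕ) * (N + 1 : ℕ) * c, mul_ne_zero (mul_ne_zero
      (Nat.cast_ne_zero.2 (by omega)) (Nat.cast_ne_zero.2 (by omega))) hc, ?_⟩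
    have h0 : MvPolynomial.pderiv 0 (MvPolynomial.X 0 ^ (a + (N + 1)) : Poly) =
        ((a + N + 1 : ℕ) : ℂ) • (MvPolynomial.X 0 ^ (a + N) : Poly) := by
      simp [Derivation.leibniz_pow, MvPolynomial.smul_eq_C_mul, ← add_assoc]
    have h1 : MvPolynomial.pderiv 1 (MvPolynomial.X 0 ^ (a + (N + 1)) : Poly) = 0 := by
      simp [Derivation.leibniz_pow, MvPolynomial.pderiv_X]
    have h2 : MvPolynomial.pderiv 1 (MvPolynomial.X 0 ^ b * MvPolynomial.X 1 ^ (N + 1) : Poly) =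
        ((N + 1 : ℕ) : ℂ) • (MvPolynomial.X 0 ^ b * MvPolynomial.X 1 ^ N : Poly) := by
      simp [Derivation.leibniz_pow, Derivation.leibniz, MvPolynomial.pderiv_X,
        MvPolynomial.smul_eq_C_mul]
      ring
    rw [trans_succ, cayley_tmul, h0, h1, h2, TensorProduct.zero_tmul, sub_zero,
      TensorProduct.tmul_smul, ← TensorProduct.smul_tmul', map_smul, map_smul, h, smul_smul,
      smul_smul]
    congr 1
    ring

/-- A submodule of `S^n(ℂ²)` that contains the highest weight vector is everything. -/
theorem eq_top_of_mem (n : ℕ) (W : LieSubmodule ℂ SL2 Poly)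
    (h0 : (MvPolynomial.X 0 ^ n : Poly) ∈ W) : S n ≤ W := by
  have key : ∀ k, k ≤ n → (MvPolynomial.X 0 ^ (n - k) * MvPolynomial.X 1 ^ k : Poly) ∈ W := by
    intro k
    induction k with
    | zero => intro _; simpa using h0
    | succ k ih =>
      intro hk
      let Y : SL2 := ⟨!![0, 0; 1, 0], by
        change Matrix.trace !![(0 : ℂ), 0; 1, 0] = 0
        simp [Matrix.trace_fin_two]⟩
      have h := W.lie_mem (x := Y) (ih (by omega))
      obtain ⟨d, rfl⟩ : ∃ d, n = k + 1 + d := ⟨n - (k + 1), by omega⟩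
      have e : ⁅Y, (MvPolynomial.X 0 ^ (k + 1 + d - k) * MvPolynomial.X 1 ^ k : Poly)⁆ =
          ((d + 1 : ℕ) : ℂ) •
            (MvPolynomial.X 0 ^ (k + 1 + d - (k + 1)) * MvPolynomial.X 1 ^ (k + 1) : Poly) := by
        rw [show k + 1 + d - k = d + 1 by omega, show k + 1 + d - (k + 1) = d by omega, lie_poly]
        simp [Derivation.leibniz_pow, Derivation.leibniz, matDer_X, Fin.sum_univ_two, Y,
          MvPolynomial.smul_eq_C_mul]
        ring
      have h' := W.smul_mem (((d + 1 : ℕ) : ℂ)⁻¹) h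
      rwa [e, smul_smul, inv_mul_cancel₀ (by exact_mod_cast Nat.succ_ne_zero d), one_smul] at h'
  intro p hp
  have hp : p.IsHomogeneous n := hp
  rw [p.as_sum]
  refine Submodule.sum_mem W.toSubmodule fun s hs => ?_
  have hd := hp (MvPolynomial.mem_support_iff.1 hs)
  have hd' : s 0 + s 1 = n := by
    rw [← hd, Finsupp.weight_apply, Finsupp.sum_fintype _ _ (by simp)]
    simp [Fin.sum_univ_two]
  have := W.smul_mem (p.coeff s) (key (s 1) (by omega))
  rw [show n - s 1 = s 0 by omega] at this
  have e : MvPolynomial.monomial s (p.coeff s) =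
      p.coeff s • (MvPolynomial.X 0 ^ s 0 * MvPolynomial.X 1 ^ s 1 : Poly) := by
    rw [MvPolynomial.monomial_eq, Finsupp.prod_fintype _ _ (by simp), Fin.prod_univ_two,
      MvPolynomial.smul_eq_C_mul]
  rw [e]
  exact this

/-- For `2m ≤ r` there is a projection of `S²(S^r(ℂ²))` onto `S^{2r-4m}(ℂ²)`. -/
theorem exists_projection (r m : ℕ) (hm : 2 * m ≤ r) :
    ∃ f : SymSq (S r) →ₗ⁅ℂ, SL2⁆ S (2 * r - 4 * m), Function.Surjective f := by
  have hmem : ∀ t : S r ⊗[ℂ] S r, trans (2 * m) (TensorProduct.LieModule.mapIncl (S r) (S r) t) ∈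
      S (2 * r - 4 * m) := by
    intro t
    induction t with
    | zero => simp
    | add x y hx hy => rw [map_add, map_add]; exact add_mem hx hy
    | tmul p q =>
      have := trans_mem (2 * m) (r - 2 * m) (r - 2 * m) p q
        (by rw [Nat.sub_add_cancel hm]; exact p.2) (by rw [Nat.sub_add_cancel hm]; exact q.2)
      rw [show r - 2 * m + (r - 2 * m) = 2 * r - 4 * m by omega] at this
      exact this
  let g : S r ⊗[ℂ] S r →ₗ⁅ℂ, SL2⁆ S (2 * r - 4 * m) :=
    { toFun := fun t => ⟨_, hmem t⟩
      map_add' := fun x y => by ext1; simp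
      map_smul' := fun c x => by ext1; simp
      map_lie' := fun {A x} => by
        ext1
        simp [trans_lie] }
  have hg : LieSubmodule.lieSpan ℂ SL2
      {t : S r ⊗[ℂ] S r | ∃ x y : S r, t = x ⊗ₜ[ℂ] y - y ⊗ₜ[ℂ] x} ≤ g.ker := by
    rw [LieSubmodule.lieSpan_le]
    rintro _ ⟨x, y, rfl⟩
    change g _ = 0
    ext1
    change trans (2 * m) _ = 0
    simp [trans_swap (2 * m) x.1 y.1]
  let f : SymSq (S r) →ₗ⁅ℂ, SL2⁆ S (2 * r - 4 * m) :=
    { Submodule.liftQ _ (g : S r ⊗[ℂ] S r →ₗ[ℂ] S (2 * r - 4 * m)) hg with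
      map_lie' := by
        intro A x
        obtain ⟨t, rfl⟩ := LieSubmodule.Quotient.surjective_mk' _ x
        rw [← LieModuleHom.map_lie]
        exact g.map_lie A t }
  have hf : ∀ t, f (LieSubmodule.Quotient.mk t) = g t := fun t => rfl
  refine ⟨f, ?_⟩
  obtain ⟨c, hc, hv⟩ := trans_value (2 * m) (r - 2 * m) (r - 2 * m)
  have hX : ∀ (i : Fin 2) (k : ℕ), (MvPolynomial.X i ^ k : Poly).IsHomogeneous k :=
    fun i k => MvPolynomial.isHomogeneous_X_pow i k
  let p : S r := ⟨MvPolynomial.X 0 ^ (r - 2 * m + 2 * m), by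
    have := hX 0 (r - 2 * m + 2 * m)
    rw [Nat.sub_add_cancel hm] at this ⊢
    exact this⟩
  let q : S r := ⟨MvPolynomial.X 0 ^ (r - 2 * m) * MvPolynomial.X 1 ^ (2 * m), by
    have := (hX 0 (r - 2 * m)).mul (hX 1 (2 * m))
    rw [Nat.sub_add_cancel hm] at this
    exact this⟩
  have htop : S (2 * r - 4 * m) ≤ f.range.map (S (2 * r - 4 * m)).incl := by
    apply eq_top_of_mem
    refine ⟨f (LieSubmodule.Quotient.mk (c⁻¹ • p ⊗ₜ[ℂ] q)), ⟨_, rfl⟩, ?_⟩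
    rw [hf, map_smul]
    change c⁻¹ • trans (2 * m) (p.1 ⊗ₜ q.1) = _
    rw [hv, smul_smul, inv_mul_cancel₀ hc, one_smul]
    congr 1
    omega
  intro w
  obtain ⟨w', ⟨x, hx⟩, hw⟩ := htop w.2
  exact ⟨x, by rw [hx]; exact Subtype.ext hw⟩

/-! ### The Zariski topology on a projective space -/

section Zariski

variable (V : Type) [AddCommGroup V] [Module ℂ V]

/-- The common zeros in `ℙ(V)` of a set of polynomials in linear forms on `V` (which is meant to
consist of homogeneous polynomials). -/
def zeroLocus (E : Set (MvPolynomial (Module.Dual ℂ V) ℂ)) : Set (ℙ ℂ V) :=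
  {x | ∀ F ∈ E, MvPolynomial.eval (fun φ : Module.Dual ℂ V => φ x.rep) F = 0}


/-- The Zariski topology on `ℙ(V)`: the closed sets are the common zeros of sets of homogeneous
polynomials. -/
@[reducible] def zariskiTopology : TopologicalSpace (ℙ ℂ V) :=
  TopologicalSpace.ofClosed
    {Z | ∃ E : Set (MvPolynomial (Module.Dual ℂ V) ℂ),
      (∀ F ∈ E, ∃ d : ℕ, F.IsHomogeneous d) ∧ Z = zeroLocus V E}
    ⟨{1}, by
      rintro F rfl
      exact ⟨0, MvPolynomial.isHomogeneous_one _ _⟩, by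
      ext x
      simp [zeroLocus]⟩
    (by
      intro A hA
      have hA' : ∀ Z ∈ A, ∃ E : Set (MvPolynomial (Module.Dual ℂ V) ℂ),
        (∀ F ∈ E, ∃ d : ℕ, F.IsHomogeneous d) ∧ Z = zeroLocus V E := fun Z hZ => hA hZ
      choose! E hE hZ using hA'
      refine ⟨⋃ Z ∈ A, E Z, ?_, ?_⟩
      · intro F hF
        simp only [Set.mem_iUnion] at hF
        obtain ⟨Z, hZA, hF⟩ := hF
        exact hE Z hZA F hF
      · ext x
        simp only [Set.mem_sInter, zeroLocus, Set.mem_iUnion, Set.mem_ofPred_eq]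
        constructor
        · rintro h F ⟨Z, hZA, hF⟩
          have := h Z hZA
          rw [hZ Z hZA] at this
          exact this F hF
        · intro h Z hZA
          rw [hZ Z hZA]
          exact fun F hF => h F ⟨Z, hZA, hF⟩)
    (by
      rintro _ ⟨E, hE, rfl⟩ _ ⟨E', hE', rfl⟩
      refine ⟨Set.image2 (· * ·) E E', ?_, ?_⟩
      · rintro _ ⟨F, hF, G, hG, rfl⟩
        obtain ⟨d, hd⟩ := hE F hF
        obtain ⟨e, he⟩ := hE' G hG
        exact ⟨d + e, hd.mul he⟩
      · ext x
        simp only [zeroLocus, Set.mem_union, Set.mem_ofPred_eq, Set.forall_mem_image2, map_mul,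
          mul_eq_zero]
        constructor
        · rintro (h | h) F hF G hG
          · exact Or.inl (h F hF)
          · exact Or.inr (h G hG)
        · intro h
          by_contra! hcon
          obtain ⟨⟨F, hF, hF0⟩, G, hG, hG0⟩ := hcon
          exact (h F hF G hG).elim hF0 hG0)

variable {V}

/-- The dimension of a subset of `ℙ(V)`: the supremum of the lengths of chains of irreducible closed
subsets in the Zariski topology. The empty set has dimension `⊥`. -/
def zariskiDim (Z : Set (ℙ ℂ V)) : WithBot ℕ∞ :=
  letI := zariskiTopology V
  topologicalKrullDim Z

end Zariski

/-! ### The varieties `M_m` -/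

/-- The variety `{x ∈ ℙ S^r(ℂ²) | f(xx) = 0}` attached to a morphism `f` from `S²(S^r(ℂ²))` to
`S^n(ℂ²)`. For the projection `f` onto `S^{2r-4m}(ℂ²)` it is `M_m`. -/
def M {r n : ℕ} (f : SymSq (S r) →ₗ⁅ℂ, SL2⁆ S n) : Set (ℙ ℂ (S r)) :=
  {x | f (symMul x.rep x.rep) = 0}

end

end BinaryForms

/-!
The idea is to find a linear subspace of `ℙ S^r(ℂ²)` of codimension `2m` that does not meet `M_m`.
Let `eᵢ = X₀^(r-i) X₁^i` be the weight vectors. The subspace is the span of the `eᵢ` with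
`m ≤ i ≤ r - m`, and it is disjoint from `M_m` as soon as `f(eᵢeᵢ) ≠ 0` for these `i`: if `eᵢ` is the
first weight vector that occurs in `x`, with coefficient `a`, then the component of `f(xx)` of the
weight of `eᵢeᵢ` is `a² f(eᵢeᵢ)`.

That `f(eᵢeᵢ) ≠ 0` (`structCoeff_square_ne_zero`) follows from equivariance alone. Lowering `eᵢeᵢ`
gives `2(r-i) eᵢeᵢ₊₁` and raising `eᵢ₊₁eᵢ₊₁` gives `2(i+1) eᵢeᵢ₊₁`. Comparing with the action on the
weight vectors of `S^(2r-4m)(ℂ²)`, if `f(eᵢ₊₁eᵢ₊₁) = 0` then `f(eᵢeᵢ₊₁) = 0` and hence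
`f(eᵢeᵢ) = 0` (for `m ≤ i < r - m`), so everything reduces to
`f(eₘeₘ) ≠ 0`. If `f(eₘeₘ) = 0`, then `f(eᵢeⱼ) = 0` for all `i + j = 2m`, because the lowering
operator does not reach the highest weight of `S^(2r-4m)(ℂ²)`;
then the highest weight vector is not in the image of `f`, which is surjective.

The bound for the dimension comes from Krull's height theorem (`zariskiDim_lt_card`). A chain of
irreducible closed subsets of `M_m` with `k` steps gives a chain of homogeneous primes with `k`
steps, strictly below the irrelevant ideal and above the ideal `I` of `M_m`. The irrelevant ideal is
minimal over `I` together with the `2m` coordinates of index `< m` or `> r - m`, so that its height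
modulo `I` is at most `2m`, and `k + 1 ≤ 2m`. The disjointness is used as a statement about primes
(`X_mem_of_vanishing_le`), and the Nullstellensatz is not needed. For `m = 0` the bound says
that the dimension is negative, that is, that `M_0` is empty.
-/

open scoped TensorProduct LinearAlgebra.Projectivization

namespace BinaryForms

/-! ### Chains of primes below a prime that is minimal over few elements -/

/-- Krull's height theorem for chains of primes above `I`: if `𝔪` is minimal over `I` and a finite
set `s`, then a strictly increasing chain of primes that contain `I` and lie strictly below `𝔪` has
fewer than `#s` steps. -/
theorem krullDim_lt_card_of_strictMono_primes {R : Type*} [CommRing R] [IsNoetherianRing R]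
    {I 𝔪 : Ideal R} {s : Finset R} (hmin : 𝔪 ∈ (I ⊔ Ideal.span s).minimalPrimes)
    {α : Type*} [Preorder α] (Ψ : α → Ideal R) (hmono : StrictMono Ψ)
    (hprime : ∀ a, (Ψ a).IsPrime) (hI : ∀ a, I ≤ Ψ a) (hlt : ∀ a, Ψ a < 𝔪) :
    Order.krullDim α < (s.card : WithBot ℕ∞) := by
  classical
  have h𝔪 : 𝔪.IsPrime := hmin.1.1
  have hI𝔪 : I ≤ 𝔪 := le_sup_left.trans hmin.1.2
  -- The chain is moved to `R ⧸ I`, whose primes are the primes of `R` that contain `I`.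
  let e := I.primeSpectrumQuotientOrderIsoZeroLocus.symm
  let P : α → PrimeSpectrum (R ⧸ I) := fun a => e ⟨⟨Ψ a, hprime a⟩, hI a⟩
  let Q : PrimeSpectrum (R ⧸ I) := e ⟨⟨𝔪, h𝔪⟩, hI𝔪⟩
  have hP : StrictMono P := fun a b hab => e.strictMono (hmono hab)
  have hPQ : ∀ a, P a < Q := fun a => e.strictMono (hlt a)
  have hQ : Q.asIdeal = 𝔪.map (Ideal.Quotient.mk I) := rfl
  have hheight : Q.asIdeal.height ≤ s.card := by
    have hmin' : Q.asIdeal ∈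
        (Ideal.span (s.image (Ideal.Quotient.mk I) : Set (R ⧸ I))).minimalPrimes := by
      have hspan : Ideal.span (s.image (Ideal.Quotient.mk I) : Set (R ⧸ I)) =
          (I ⊔ Ideal.span s).map (Ideal.Quotient.mk I) := by
        rw [Ideal.map_sup, Ideal.map_quotient_self, bot_sup_eq, Ideal.map_span, Finset.coe_image]
      rw [hspan]
      refine ⟨⟨Q.isPrime, hQ ▸ Ideal.map_mono hmin.1.2⟩, ?_⟩
      rintro q ⟨hq, hle⟩ hqQ
      rw [hQ, Ideal.map_le_iff_le_comap]
      refine hmin.2 ⟨hq.comap _, Ideal.map_le_iff_le_comap.1 hle⟩ ?_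
      refine (Ideal.comap_mono hqQ).trans ?_
      rw [hQ, Ideal.comap_map_of_surjective _ Ideal.Quotient.mk_surjective,
        ← RingHom.ker_eq_comap_bot, Ideal.mk_ker, sup_eq_left.2 hI𝔪]
    refine (Ideal.height_le_card_of_mem_minimalPrimes_span_finset
      (s := s.image (Ideal.Quotient.mk I)) hmin').trans ?_
    exact_mod_cast Finset.card_image_le
  rw [Order.krullDim_lt_coe_iff]
  intro l
  have h1 : (l.length : ℕ∞) ≤ (P l.last).asIdeal.height := by
    rw [PrimeSpectrum.height_eq_orderHeight]
    exact Order.length_le_height_last (p := l.map P hP)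
  have h2 : (P l.last).asIdeal.height + 1 ≤ Q.asIdeal.height :=
    Ideal.height_add_one_le_of_lt_of_isPrime (hPQ _)
  have h3 : ((l.length + 1 : ℕ) : ℕ∞) ≤ s.card := by
    push_cast
    exact (add_le_add_left h1 1).trans (h2.trans hheight)
  exact_mod_cast h3

/-! ### Homogeneous vanishing ideals -/

section Vanishing

variable {ι : Type} {V : Type} [AddCommGroup V] [Module ℂ V]

/-- The restriction of polynomials to the line through `v`, as polynomials in a parameter. -/
noncomputable def lineHom (v : ι → ℂ) : MvPolynomial ι ℂ →ₐ[ℂ] Polynomial ℂ :=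
  MvPolynomial.aeval fun i => Polynomial.C (v i) * Polynomial.X

/-- The homogeneous ideal of a subset of `ℙ(V)` in the coordinate ring of a basis `b`: the
polynomials that vanish on all the lines in the cone over the subset. -/
noncomputable def vanishing (b : Module.Basis ι ℂ V) (W : Set (ℙ ℂ V)) :
    Ideal (MvPolynomial ι ℂ) :=
  ⨅ x ∈ W, RingHom.ker (lineHom (b.repr x.rep))

variable (b : Module.Basis ι ℂ V)

theorem mem_vanishing {W : Set (ℙ ℂ V)} {F : MvPolynomial ι ℂ} :
    F ∈ vanishing b W ↔ ∀ x ∈ W, lineHom (b.repr x.rep) F = 0 := by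
  simp [vanishing, RingHom.mem_ker]

theorem vanishing_anti {W W' : Set (ℙ ℂ V)} (h : W ⊆ W') : vanishing b W' ≤ vanishing b W :=
  fun _ hF => (mem_vanishing b).2 fun x hx => (mem_vanishing b).1 hF x (h hx)

theorem ker_constantCoeff_eq_span :
    RingHom.ker (MvPolynomial.constantCoeff (σ := ι) (R := ℂ)) =
      Ideal.span (Set.range MvPolynomial.X) := by
  ext F
  rw [RingHom.mem_ker, ← Set.image_univ, MvPolynomial.mem_ideal_span_X_image]
  constructor
  · intro hF s hs
    by_contra! h
    have h0 : s = 0 := Finsupp.ext fun i => h i (Set.mem_univ i)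
    exact MvPolynomial.mem_support_iff.1 hs (h0 ▸ hF)
  · intro h
    by_contra hF
    obtain ⟨i, -, hi⟩ := h 0 (MvPolynomial.mem_support_iff.2 hF)
    exact hi rfl

theorem isClosed_zariski_iff {C : Set (ℙ ℂ V)} :
    @IsClosed _ (zariskiTopology V) C ↔ ∃ E : Set (MvPolynomial (Module.Dual ℂ V) ℂ),
      (∀ F ∈ E, ∃ d : ℕ, F.IsHomogeneous d) ∧ C = zeroLocus V E := by
  rw [← @isOpen_compl_iff _ _ (zariskiTopology V)]
  change (Cᶜᶜ ∈ _) ↔ _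
  rw [compl_compl]
  rfl

/-- The locus of zeros of a homogeneous polynomial in the coordinates of a basis is closed. -/
theorem isClosed_zeros {F : MvPolynomial ι ℂ} {d : ℕ} (hF : F.IsHomogeneous d) :
    @IsClosed _ (zariskiTopology V) {x : ℙ ℂ V | MvPolynomial.eval (b.repr x.rep) F = 0} := by
  rw [isClosed_zariski_iff]
  refine ⟨{MvPolynomial.rename (fun i => b.coord i) F}, ?_, ?_⟩
  · rintro _ rfl
    exact ⟨d, hF.rename_isHomogeneous⟩
  · ext x
    simp [zeroLocus, MvPolynomial.eval_rename, Function.comp_def]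

variable [Fintype ι]

theorem lineHom_of_isHomogeneous (v : ι → ℂ) {F : MvPolynomial ι ℂ} {d : ℕ}
    (hF : F.IsHomogeneous d) :
    lineHom v F = Polynomial.C (MvPolynomial.eval v F) * Polynomial.X ^ d := by
  rw [lineHom, MvPolynomial.aeval_def, MvPolynomial.eval₂_eq', MvPolynomial.eval_eq', map_sum,
    Finset.sum_mul]
  refine Finset.sum_congr rfl fun s hs => ?_
  have hd : ∑ i, s i = d := by
    rw [← hF (MvPolynomial.mem_support_iff.1 hs), Finsupp.weight_apply,
      Finsupp.sum_fintype _ _ (by simp)]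
    simp
  simp only [mul_pow, Finset.prod_mul_distrib, Finset.prod_pow_eq_pow_sum, hd, map_mul, map_prod,
    map_pow, Polynomial.algebraMap_eq, mul_assoc]

theorem coeff_lineHom (v : ι → ℂ) (F : MvPolynomial ι ℂ) (n : ℕ) :
    (lineHom v F).coeff n = MvPolynomial.eval v (MvPolynomial.homogeneousComponent n F) := by
  conv_lhs => rw [← MvPolynomial.sum_homogeneousComponent F]
  rw [map_sum, Polynomial.finsetSum_coeff]
  simp only [lineHom_of_isHomogeneous v (MvPolynomial.homogeneousComponent_isHomogeneous _ F),
    Polynomial.coeff_C_mul, Polynomial.coeff_X_pow, mul_ite, mul_one, mul_zero]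
  rw [Finset.sum_ite_eq]
  split_ifs with h
  · rfl
  · rw [MvPolynomial.homogeneousComponent_eq_zero _ _ (by simpa using h), map_zero]

theorem mem_vanishing_of_isHomogeneous {W : Set (ℙ ℂ V)} {F : MvPolynomial ι ℂ} {d : ℕ}
    (hF : F.IsHomogeneous d) :
    F ∈ vanishing b W ↔ ∀ x ∈ W, MvPolynomial.eval (b.repr x.rep) F = 0 := by
  simp [mem_vanishing, lineHom_of_isHomogeneous _ hF]

attribute [local instance] MvPolynomial.gradedAlgebra

theorem vanishing_isHomogeneous (W : Set (ℙ ℂ V)) :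
    (vanishing b W).IsHomogeneous (MvPolynomial.homogeneousSubmodule ι ℂ) := by
  intro n F hF
  have h : ((DirectSum.decompose (MvPolynomial.homogeneousSubmodule ι ℂ) F n :
      MvPolynomial.homogeneousSubmodule ι ℂ n) : MvPolynomial ι ℂ) =
      MvPolynomial.homogeneousComponent n F := MvPolynomial.decomposition.decompose'_apply F n
  rw [h, mem_vanishing_of_isHomogeneous b (MvPolynomial.homogeneousComponent_isHomogeneous n F)]
  intro x hx
  rw [← coeff_lineHom, (mem_vanishing b).1 hF x hx, Polynomial.coeff_zero]

/-- A point outside a closed set is separated from it by a homogeneous polynomial in the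
coordinates of a basis. -/
theorem exists_homogeneous_separating {C : Set (ℙ ℂ V)} (hC : @IsClosed _ (zariskiTopology V) C)
    {x : ℙ ℂ V} (hx : x ∉ C) : ∃ (F : MvPolynomial ι ℂ) (d : ℕ), F.IsHomogeneous d ∧
      (∀ y ∈ C, MvPolynomial.eval (b.repr y.rep) F = 0) ∧
        MvPolynomial.eval (b.repr x.rep) F ≠ 0 := by
  obtain ⟨E, hE, rfl⟩ := isClosed_zariski_iff.1 hC
  simp only [zeroLocus, Set.mem_ofPred_eq, not_forall] at hx
  obtain ⟨G, hG, hGx⟩ := hx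
  obtain ⟨d, hd⟩ := hE G hG
  let g : Module.Dual ℂ V → MvPolynomial ι ℂ := fun φ =>
    ∑ i, MvPolynomial.C (φ (b i)) * MvPolynomial.X i
  have hg : ∀ φ, (g φ).IsHomogeneous 1 := fun φ =>
    MvPolynomial.IsHomogeneous.sum _ _ _ fun i _ => by
      simpa using (MvPolynomial.isHomogeneous_C ι (φ (b i))).mul (MvPolynomial.isHomogeneous_X ℂ i)
  have heval : ∀ v : V, MvPolynomial.eval (b.repr v) (MvPolynomial.aeval g G) =
      MvPolynomial.eval (fun φ : Module.Dual ℂ V => φ v) G := by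
    intro v
    have hφ : ∀ φ : Module.Dual ℂ V, MvPolynomial.eval (b.repr v) (g φ) = φ v := by
      intro φ
      conv_rhs => rw [← b.sum_repr v, map_sum]
      simp only [g, map_sum, map_mul, MvPolynomial.eval_C, MvPolynomial.eval_X, map_smul,
        smul_eq_mul, mul_comm]
    have hC : (MvPolynomial.eval (b.repr v)).comp MvPolynomial.C = RingHom.id ℂ :=
      RingHom.ext fun z => MvPolynomial.eval_C z
    rw [MvPolynomial.aeval_def, MvPolynomial.algebraMap_eq, MvPolynomial.eval₂_comp_left, hC,
      show MvPolynomial.eval (b.repr v) ∘ g = fun φ => φ v from funext hφ]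
    rfl
  refine ⟨MvPolynomial.aeval g G, 1 * d, hd.aeval g hg, ?_, ?_⟩
  · intro y hy
    rw [heval]
    exact hy G hG
  · rwa [heval]

theorem vanishing_isPrime {W : Set (ℙ ℂ V)} (hW : @IsIrreducible _ (zariskiTopology V) W) :
    (vanishing b W).IsPrime := by
  let := zariskiTopology V
  obtain ⟨x, hx⟩ := hW.1
  refine (vanishing_isHomogeneous b W).isPrime_of_homogeneous_mem_or_mem ?_ ?_
  · rw [Ideal.ne_top_iff_one]
    intro h
    simpa using (mem_vanishing b).1 h x hx
  · rintro F G ⟨d, hF⟩ ⟨e, hG⟩ hFG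
    have hF : F.IsHomogeneous d := hF
    have hG : G.IsHomogeneous e := hG
    rw [mem_vanishing_of_isHomogeneous b (hF.mul hG)] at hFG
    rw [mem_vanishing_of_isHomogeneous b hF, mem_vanishing_of_isHomogeneous b hG]
    refine isPreirreducible_iff_isClosed_union_isClosed.1 hW.2 _ _ (isClosed_zeros b hF)
      (isClosed_zeros b hG) fun y hy => ?_
    have h := hFG y hy
    rw [map_mul, mul_eq_zero] at h
    exact h

/-- The ideal of a nonempty set is strictly smaller than the ideal of the origin. -/
theorem vanishing_lt_irrelevant {W : Set (ℙ ℂ V)} (hW : W.Nonempty) :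
    vanishing b W < Ideal.span (Set.range MvPolynomial.X) := by
  obtain ⟨x, hx⟩ := hW
  refine lt_of_le_of_ne (fun F hF => ?_) fun h => ?_
  · have h0 := congrArg (Polynomial.eval 0) ((mem_vanishing b).1 hF x hx)
    have h1 : MvPolynomial.constantCoeff F = 0 := by
      have h2 := coeff_lineHom (b.repr x.rep) F 0
      rw [(mem_vanishing b).1 hF x hx, MvPolynomial.homogeneousComponent_zero] at h2
      simpa [MvPolynomial.constantCoeff_eq] using h2.symm
    rwa [← ker_constantCoeff_eq_span, RingHom.mem_ker]
  · apply x.rep_nonzero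
    apply b.repr.injective
    ext i
    have hi : MvPolynomial.X i ∈ vanishing b W := h ▸ Ideal.subset_span ⟨i, rfl⟩
    simpa using (mem_vanishing_of_isHomogeneous b (MvPolynomial.isHomogeneous_X ℂ i)).1 hi x hx

/-! ### A bound for the dimension of a projective set -/

/-- If the origin is the only common zero of the ideal of `Z` and the coordinates in a set `T`, in
the strong sense that every prime that contains them contains all coordinates, then
`dim Z < #T`. -/
theorem zariskiDim_lt_card (Z : Set (ℙ ℂ V)) (T : Finset ι)
    (hT : ∀ Q : Ideal (MvPolynomial ι ℂ), Q.IsPrime → vanishing b Z ≤ Q →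
      (∀ i ∈ T, MvPolynomial.X i ∈ Q) → ∀ i, MvPolynomial.X i ∈ Q) :
    zariskiDim Z < (T.card : WithBot ℕ∞) := by
  classical
  let := zariskiTopology V
  set 𝔪 : Ideal (MvPolynomial ι ℂ) := Ideal.span (Set.range MvPolynomial.X) with h𝔪
  change Order.krullDim (TopologicalSpace.IrreducibleCloseds Z) < _
  rcases Set.eq_empty_or_nonempty Z with rfl | hne
  · have : IsEmpty (TopologicalSpace.IrreducibleCloseds (∅ : Set (ℙ ℂ V))) :=
      ⟨fun W => W.isIrreducible'.1.some.2⟩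
    rw [Order.krullDim_eq_bot]
    exact WithBot.bot_lt_coe _
  have hprime𝔪 : 𝔪.IsPrime := by
    rw [h𝔪, ← ker_constantCoeff_eq_span]
    exact RingHom.ker_isPrime _
  have hmin : 𝔪 ∈ (vanishing b Z ⊔ Ideal.span
      (T.image (MvPolynomial.X : ι → MvPolynomial ι ℂ))).minimalPrimes := by
    refine ⟨⟨hprime𝔪, sup_le (vanishing_lt_irrelevant b hne).le (Ideal.span_mono ?_)⟩, ?_⟩
    · rw [Finset.coe_image]
      exact Set.image_subset_range _ _
    · rintro Q ⟨hQ, hle⟩ -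
      rw [h𝔪, Ideal.span_le]
      rintro _ ⟨i, rfl⟩
      refine hT Q hQ (le_sup_left.trans hle) (fun j hj => le_sup_right.trans hle ?_) i
      exact Ideal.subset_span (Finset.mem_coe.2 (Finset.mem_image_of_mem _ hj))
  -- Passing to ideals reverses inclusions, hence the order dual.
  rw [← Order.krullDim_orderDual]
  have hcard : (T.image (MvPolynomial.X : ι → MvPolynomial ι ℂ)).card = T.card :=
    Finset.card_image_of_injective _ MvPolynomial.X_injective
  rw [← hcard]
  let A : TopologicalSpace.IrreducibleCloseds Z → Set (ℙ ℂ V) := fun W => (↑) '' W.carrier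
  have hA : ∀ W, IsIrreducible (A W) := fun W =>
    W.isIrreducible'.image _ continuous_subtype_val.continuousOn
  refine krullDim_lt_card_of_strictMono_primes hmin
    (fun W => vanishing b (A (OrderDual.ofDual W))) ?_ (fun W => vanishing_isPrime b (hA _))
    (fun W => vanishing_anti b ?_) (fun W => vanishing_lt_irrelevant b (hA _).1)
  · -- A closed set is recovered from the homogeneous polynomials that vanish on it.
    intro W₂ W₁ (h : OrderDual.ofDual W₁ < OrderDual.ofDual W₂)
    refine lt_of_le_not_ge (vanishing_anti b (Set.image_mono h.le)) fun hle => ?_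
    obtain ⟨x, hx₂, hx₁⟩ := Set.not_subset.1 (not_le_of_gt h)
    obtain ⟨C, hC, hCW⟩ := isClosed_induced_iff.1 (OrderDual.ofDual W₁).isClosed'
    have hxC : x.1 ∉ C := fun hxC => hx₁ (hCW ▸ hxC : x ∈ (OrderDual.ofDual W₁).carrier)
    obtain ⟨F, d, hF, hFC, hFx⟩ := exists_homogeneous_separating b hC hxC
    refine hFx ((mem_vanishing_of_isHomogeneous b hF).1 (hle ?_) x.1 ⟨x, hx₂, rfl⟩)
    rw [mem_vanishing_of_isHomogeneous b hF]
    rintro _ ⟨y, hy, rfl⟩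
    exact hFC _ (hCW.symm ▸ hy : y ∈ Subtype.val ⁻¹' C)
  · rintro _ ⟨y, -, rfl⟩
    exact y.2

theorem eq_empty_of_zariskiDim_lt_zero {Z : Set (ℙ ℂ V)} (h : zariskiDim Z < 0) : Z = ∅ := by
  let := zariskiTopology V
  rw [Set.eq_empty_iff_forall_notMem]
  intro x hx
  have : Nonempty (TopologicalSpace.IrreducibleCloseds Z) :=
    ⟨⟨closure {⟨x, hx⟩}, isIrreducible_singleton.closure, isClosed_closure⟩⟩
  exact absurd h (not_lt.2 Order.krullDim_nonneg)

end Vanishing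

/-! ### The weight basis of `S^r(ℂ²)` -/

/-- The exponent of the monomial `X₀^(r-i) X₁^i`, and of `X₁^i` for `i > r`. -/
noncomputable def expo (r i : ℕ) : Fin 2 →₀ ℕ :=
  Finsupp.single 0 (r - i) + Finsupp.single 1 i

theorem expo_injective (r : ℕ) : Function.Injective (expo r) := fun i j h => by
  simpa [expo] using DFunLike.congr_fun h 1

theorem degree_expo {r i : ℕ} (hi : i ≤ r) : (expo r i).degree = r := by
  simp [expo, Finsupp.degree_eq_sum, Fin.sum_univ_two]
  omega

theorem eq_expo {r : ℕ} {s : Fin 2 →₀ ℕ} (hs : s.degree = r) : s = expo r (s 1) := by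
  have h : s 0 + s 1 = r := by rw [← hs, Finsupp.degree_eq_sum, Fin.sum_univ_two]
  ext i
  fin_cases i
  · simp [expo]
    omega
  · simp [expo]

/-- The weight vector `X₀^(r-i) X₁^i` of `S^r(ℂ²)`; it is `0` for `i > r`. -/
noncomputable def weightVec (r i : ℕ) : S r :=
  if h : i ≤ r then ⟨MvPolynomial.monomial (expo r i) 1,
    MvPolynomial.isHomogeneous_monomial _ (degree_expo h)⟩ else 0

theorem coe_weightVec {r i : ℕ} (h : i ≤ r) :
    (weightVec r i : Poly) = MvPolynomial.X 0 ^ (r - i) * MvPolynomial.X 1 ^ i := by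
  rw [weightVec, dif_pos h]
  change MvPolynomial.monomial (expo r i) (1 : ℂ) = _
  rw [MvPolynomial.monomial_eq, Finsupp.prod_fintype _ _ (by simp), Fin.prod_univ_two]
  simp [expo]

/-- The coefficient of `X₀^(r-i) X₁^i`; for `i > r` it is the coefficient of `X₁^i`,
which is `0` on `S^r(ℂ²)`. -/
noncomputable def weightCoeff (r i : ℕ) : S r →ₗ[ℂ] ℂ :=
  MvPolynomial.lcoeff ℂ (expo r i) ∘ₗ (S r).toSubmodule.subtype

theorem weightCoeff_apply (r i : ℕ) (p : S r) : weightCoeff r i p = (p : Poly).coeff (expo r i) :=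
  rfl

theorem weightCoeff_weightVec {r i : ℕ} (hi : i ≤ r) (k : ℕ) :
    weightCoeff r k (weightVec r i) = if i = k then 1 else 0 := by
  rw [weightCoeff_apply, weightVec, dif_pos hi]
  simp [MvPolynomial.coeff_monomial, (expo_injective r).eq_iff]

/-- The weight vectors form a basis of `S^r(ℂ²)`. -/
noncomputable def weightBasis (r : ℕ) : Module.Basis (Fin (r + 1)) ℂ (S r) :=
  Module.Basis.ofEquivFun
    { toFun := fun p i => weightCoeff r i p
      map_add' := fun p q => by ext; simp
      map_smul' := fun c p => by ext; simp
      invFun := fun a => ∑ i : Fin (r + 1), a i • weightVec r i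
      left_inv := fun p => by
        have hp : (p : Poly).IsHomogeneous r := p.2
        ext s
        by_cases hs : s.degree = r
        · have h1 : s 1 < r + 1 := by
            have : s 0 + s 1 = r := by rw [← hs, Finsupp.degree_eq_sum, Fin.sum_univ_two]
            omega
          rw [eq_expo hs]
          change weightCoeff r (s 1) _ = weightCoeff r (s 1) p
          rw [map_sum, Finset.sum_eq_single ⟨s 1, h1⟩]
          · simp [weightCoeff_weightVec (Nat.lt_succ_iff.1 h1)]
          · intro i _ hi
            rw [map_smul, weightCoeff_weightVec (Nat.lt_succ_iff.1 i.2), if_neg, smul_zero]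
            exact fun h => hi (Fin.ext h)
          · simp
        · have key : ∀ q : S r, (q : Poly).coeff s = 0 := fun q =>
            MvPolynomial.IsHomogeneous.coeff_eq_zero (φ := (q : Poly)) q.2 hs
          rw [key, key]
      right_inv := fun a => by
        ext i
        simp only [map_sum, map_smul]
        rw [Finset.sum_eq_single i]
        · simp [weightCoeff_weightVec (Nat.lt_succ_iff.1 i.2)]
        · intro j _ hj
          rw [weightCoeff_weightVec (Nat.lt_succ_iff.1 j.2), if_neg, smul_zero]
          exact fun h => hj (Fin.ext h)
        · simp }

theorem weightBasis_repr (r : ℕ) (p : S r) (i : Fin (r + 1)) :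
    (weightBasis r).repr p i = weightCoeff r i p := rfl

theorem weightBasis_apply (r : ℕ) (i : Fin (r + 1)) : weightBasis r i = weightVec r i := by
  rw [weightBasis, Module.Basis.coe_ofEquivFun]
  change ∑ j : Fin (r + 1), (Pi.single i 1 : Fin (r + 1) → ℂ) j • weightVec r j = _
  simp [Pi.single_apply]

/-! ### The action of `sl₂(ℂ)` in the weight basis -/

/-- The raising operator `X₀ ∂₁`. -/
def raise : SL2 := ⟨!![0, 1; 0, 0], by
  change Matrix.trace !![(0 : ℂ), 1; 0, 0] = 0
  simp [Matrix.trace_fin_two]⟩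

/-- The lowering operator `X₁ ∂₀`. -/
def lower : SL2 := ⟨!![0, 0; 1, 0], by
  change Matrix.trace !![(0 : ℂ), 0; 1, 0] = 0
  simp [Matrix.trace_fin_two]⟩

/-- The weight operator `X₀ ∂₀ - X₁ ∂₁`. -/
def cartan : SL2 := ⟨!![1, 0; 0, -1], by
  change Matrix.trace !![(1 : ℂ), 0; 0, -1] = 0
  simp [Matrix.trace_fin_two]⟩

/-- For `i = 0` both sides vanish, whatever the value of `i - 1`. -/
theorem raise_weightVec {r i : ℕ} (hi : i ≤ r) :
    ⁅raise, weightVec r i⁆ = (i : ℂ) • weightVec r (i - 1) := by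
  apply Subtype.ext
  rw [LieSubmodule.coe_bracket, lie_poly, LieSubmodule.coe_smul, coe_weightVec hi,
    coe_weightVec (by omega)]
  rcases i with _ | i
  · simp [raise, matDer_apply, Fin.sum_univ_two, Derivation.leibniz_pow, MvPolynomial.pderiv_X]
  · obtain ⟨d, rfl⟩ : ∃ d, r = i + 1 + d := ⟨r - (i + 1), by omega⟩
    rw [show i + 1 + d - (i + 1) = d by omega, show i + 1 + d - (i + 1 - 1) = d + 1 by omega]
    simp [raise, matDer_X, Fin.sum_univ_two, Derivation.leibniz_pow, Derivation.leibniz,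
      MvPolynomial.smul_eq_C_mul]
    ring

theorem lower_weightVec {r i : ℕ} (hi : i ≤ r) :
    ⁅lower, weightVec r i⁆ = ((r : ℂ) - i) • weightVec r (i + 1) := by
  rcases hi.eq_or_lt with rfl | hi'
  · rw [sub_self, zero_smul]
    apply Subtype.ext
    rw [LieSubmodule.coe_bracket, lie_poly, coe_weightVec hi]
    simp [lower, matDer_X, Fin.sum_univ_two, Derivation.leibniz_pow]
  · apply Subtype.ext
    rw [LieSubmodule.coe_bracket, lie_poly, LieSubmodule.coe_smul, coe_weightVec hi,
      coe_weightVec (by omega)]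
    obtain ⟨d, rfl⟩ : ∃ d, r = i + 1 + d := ⟨r - (i + 1), by omega⟩
    rw [show i + 1 + d - i = d + 1 by omega, show i + 1 + d - (i + 1) = d by omega]
    simp [lower, matDer_X, Fin.sum_univ_two, Derivation.leibniz_pow, Derivation.leibniz,
      MvPolynomial.smul_eq_C_mul]
    ring

theorem cartan_weightVec {r i : ℕ} (hi : i ≤ r) :
    ⁅cartan, weightVec r i⁆ = ((r : ℂ) - 2 * i) • weightVec r i := by
  apply Subtype.ext
  rw [LieSubmodule.coe_bracket, lie_poly, LieSubmodule.coe_smul, coe_weightVec hi]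
  obtain ⟨d, rfl⟩ : ∃ d, r = i + d := ⟨r - i, by omega⟩
  rw [show i + d - i = d by omega, show ((i + d : ℕ) : ℂ) - 2 * i = d - i by push_cast; ring]
  rcases i with _ | i <;> rcases d with _ | d <;>
  · simp [cartan, matDer_X, Fin.sum_univ_two, Derivation.leibniz_pow, Derivation.leibniz,
      MvPolynomial.smul_eq_C_mul]
    try first | ring1 | exact Or.inl (by ring)

theorem weightCoeff_raise (r k : ℕ) (p : S r) :
    weightCoeff r k ⁅raise, p⁆ = ((k : ℂ) + 1) * weightCoeff r (k + 1) p := by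
  let L : S r →ₗ[ℂ] ℂ := weightCoeff r k ∘ₗ (LieModule.toEnd ℂ SL2 (S r) raise : S r →ₗ[ℂ] S r)
  let R : S r →ₗ[ℂ] ℂ := ((k : ℂ) + 1) • weightCoeff r (k + 1)
  suffices L = R from LinearMap.congr_fun this p
  refine (weightBasis r).ext fun i => ?_
  have hi := Nat.lt_succ_iff.1 i.2
  rw [weightBasis_apply]
  change weightCoeff r k ⁅raise, weightVec r i⁆ = ((k : ℂ) + 1) * weightCoeff r (k + 1) _
  rw [raise_weightVec hi, map_smul, weightCoeff_weightVec (by omega), weightCoeff_weightVec hi]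
  generalize (i : ℕ) = j
  rcases j with _ | j
  · simp
  · simp only [Nat.add_sub_cancel, add_left_inj]
    split_ifs with h
    · subst h; simp
    · simp

theorem weightCoeff_lower_succ {r k : ℕ} (hk : k < r) (p : S r) :
    weightCoeff r (k + 1) ⁅lower, p⁆ = ((r : ℂ) - k) * weightCoeff r k p := by
  let L : S r →ₗ[ℂ] ℂ :=
    weightCoeff r (k + 1) ∘ₗ (LieModule.toEnd ℂ SL2 (S r) lower : S r →ₗ[ℂ] S r)
  let R : S r →ₗ[ℂ] ℂ := ((r : ℂ) - k) • weightCoeff r k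
  suffices L = R from LinearMap.congr_fun this p
  refine (weightBasis r).ext fun i => ?_
  have hi := Nat.lt_succ_iff.1 i.2
  rw [weightBasis_apply]
  change weightCoeff r (k + 1) ⁅lower, weightVec r i⁆ = ((r : ℂ) - k) * weightCoeff r k _
  rw [lower_weightVec hi, map_smul, weightCoeff_weightVec hi]
  rcases hi.eq_or_lt with h | h
  · rw [h, if_neg (by omega)]
    simp
  · rw [weightCoeff_weightVec (by omega)]
    simp only [add_left_inj]
    split_ifs with h
    · rw [h]; simp
    · simp

theorem weightCoeff_lower_zero (r : ℕ) (p : S r) : weightCoeff r 0 ⁅lower, p⁆ = 0 := by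
  let L : S r →ₗ[ℂ] ℂ := weightCoeff r 0 ∘ₗ (LieModule.toEnd ℂ SL2 (S r) lower : S r →ₗ[ℂ] S r)
  suffices L = 0 from LinearMap.congr_fun this p
  refine (weightBasis r).ext fun i => ?_
  have hi := Nat.lt_succ_iff.1 i.2
  rw [weightBasis_apply]
  change weightCoeff r 0 ⁅lower, weightVec r i⁆ = 0
  rw [lower_weightVec hi, map_smul]
  rcases hi.eq_or_lt with h | h
  · rw [h, sub_self, zero_smul]
  · rw [weightCoeff_weightVec (by omega)]
    simp

theorem weightCoeff_cartan (r k : ℕ) (p : S r) :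
    weightCoeff r k ⁅cartan, p⁆ = ((r : ℂ) - 2 * k) * weightCoeff r k p := by
  let L : S r →ₗ[ℂ] ℂ := weightCoeff r k ∘ₗ (LieModule.toEnd ℂ SL2 (S r) cartan : S r →ₗ[ℂ] S r)
  let R : S r →ₗ[ℂ] ℂ := ((r : ℂ) - 2 * k) • weightCoeff r k
  suffices L = R from LinearMap.congr_fun this p
  refine (weightBasis r).ext fun i => ?_
  have hi := Nat.lt_succ_iff.1 i.2
  rw [weightBasis_apply]
  change weightCoeff r k ⁅cartan, weightVec r i⁆ = ((r : ℂ) - 2 * k) * weightCoeff r k _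
  rw [cartan_weightVec hi, map_smul, weightCoeff_weightVec hi]
  split_ifs with h
  · rw [h]; simp
  · simp

/-! ### Equivariant symmetric products in weight coordinates -/

section SymMul

variable {V : Type} [AddCommGroup V] [Module ℂ V] [LieRingModule SL2 V] [LieModule ℂ SL2 V]

theorem symMul_comm (x y : V) : symMul x y = symMul y x := by
  rw [← sub_eq_zero]
  change LieSubmodule.Quotient.mk' (LieSubmodule.lieSpan ℂ SL2
    {t : V ⊗[ℂ] V | ∃ x y : V, t = x ⊗ₜ[ℂ] y - y ⊗ₜ[ℂ] x}) (x ⊗ₜ[ℂ] y - y ⊗ₜ[ℂ] x) = 0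
  rw [LieSubmodule.Quotient.mk_eq_zero]
  exact LieSubmodule.subset_lieSpan ⟨x, y, rfl⟩

theorem lie_symMul (A : SL2) (x y : V) :
    ⁅A, symMul x y⁆ = symMul ⁅A, x⁆ y + symMul x ⁅A, y⁆ := by
  change (LieSubmodule.Quotient.mk ⁅A, x ⊗ₜ[ℂ] y⁆ : SymSq V) = _
  rw [TensorProduct.LieModule.lie_tmul_right]
  rfl

variable (V) in
/-- The product `(x, y) ↦ xy` with values in `S²(V)` as a bilinear map. -/
noncomputable def symMulBilin : V →ₗ[ℂ] V →ₗ[ℂ] SymSq V :=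
  (TensorProduct.mk ℂ V V).compr₂ (LieSubmodule.Quotient.mk'
    (LieSubmodule.lieSpan ℂ SL2 {t : V ⊗[ℂ] V | ∃ x y : V, t = x ⊗ₜ[ℂ] y - y ⊗ₜ[ℂ] x}) :
      V ⊗[ℂ] V →ₗ[ℂ] SymSq V)

/-- A linear functional on `S²(V)` that vanishes on all products vanishes. -/
theorem symSq_linear_ext {φ : SymSq V →ₗ[ℂ] ℂ} (h : ∀ x y, φ (symMul x y) = 0) : φ = 0 := by
  ext w
  obtain ⟨t, rfl⟩ := LieSubmodule.Quotient.surjective_mk' _ w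
  induction t with
  | zero => simp
  | add s t hs ht => rw [map_add, map_add, hs, ht, map_add]
  | tmul x y => exact h x y

end SymMul

variable {r n : ℕ} (f : SymSq (S r) →ₗ⁅ℂ, SL2⁆ S n)

/-- The bilinear map `(x, y) ↦ f(xy)`. -/
noncomputable def pairing : S r →ₗ[ℂ] S r →ₗ[ℂ] S n :=
  (symMulBilin (S r)).compr₂ (f : SymSq (S r) →ₗ[ℂ] S n)

theorem pairing_apply (x y : S r) : pairing f x y = f (symMul x y) := rfl

theorem lie_pairing (A : SL2) (x y : S r) :
    ⁅A, pairing f x y⁆ = pairing f ⁅A, x⁆ y + pairing f x ⁅A, y⁆ := by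
  simp only [pairing_apply, ← LieModuleHom.map_lie, lie_symMul, map_add]

/-- The `k`-th weight coordinate of the image of the product of the `i`-th and the `j`-th weight
vector. -/
noncomputable def structCoeff (k i j : ℕ) : ℂ :=
  weightCoeff n k (pairing f (weightVec r i) (weightVec r j))

theorem structCoeff_comm (k i j : ℕ) : structCoeff f k i j = structCoeff f k j i := by
  rw [structCoeff, structCoeff, pairing_apply, symMul_comm, ← pairing_apply]

theorem weightCoeff_pairing (k : ℕ) (x y : S r) :
    weightCoeff n k (pairing f x y) = ∑ i : Fin (r + 1), ∑ j : Fin (r + 1),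
      weightCoeff r i x * weightCoeff r j y * structCoeff f k i j := by
  let B : S r →ₗ[ℂ] S r →ₗ[ℂ] ℂ := (pairing f).compr₂ (weightCoeff n k)
  have hB : ∀ x y, weightCoeff n k (pairing f x y) = B x y := fun _ _ => rfl
  rw [hB, ← LinearMap.sum_repr_mul_repr_mul (weightBasis r) (weightBasis r) x y]
  simp only [Finsupp.sum_fintype, zero_mul, mul_zero, Finset.sum_const_zero,
    implies_true, weightBasis_repr, weightBasis_apply, ← hB, smul_eq_mul, ← mul_assoc]
  rfl

theorem structCoeff_raise {i j : ℕ} (hi : i ≤ r) (hj : j ≤ r) (k : ℕ) :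
    ((k : ℂ) + 1) * structCoeff f (k + 1) i j =
      i * structCoeff f k (i - 1) j + j * structCoeff f k i (j - 1) := by
  rw [structCoeff, ← weightCoeff_raise, lie_pairing, raise_weightVec hi, raise_weightVec hj]
  simp [structCoeff]

theorem structCoeff_lower_succ {i j k : ℕ} (hi : i ≤ r) (hj : j ≤ r) (hk : k < n) :
    ((n : ℂ) - k) * structCoeff f k i j =
      (r - i) * structCoeff f (k + 1) (i + 1) j + (r - j) * structCoeff f (k + 1) i (j + 1) := by
  rw [structCoeff, ← weightCoeff_lower_succ hk, lie_pairing, lower_weightVec hi,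
    lower_weightVec hj]
  simp [structCoeff]

theorem structCoeff_lower_zero {i j : ℕ} (hi : i ≤ r) (hj : j ≤ r) :
    (r - i) * structCoeff f 0 (i + 1) j + (r - j) * structCoeff f 0 i (j + 1) = 0 := by
  rw [← weightCoeff_lower_zero n (pairing f (weightVec r i) (weightVec r j)), lie_pairing,
    lower_weightVec hi, lower_weightVec hj]
  simp [structCoeff]

variable {m : ℕ}

/-- Equivariance under the weight operator: products of weight vectors are sent to multiples of
weight vectors. -/
theorem structCoeff_eq_zero (hn : n + 4 * m = 2 * r) {i j k : ℕ} (hi : i ≤ r) (hj : j ≤ r)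
    (h : i + j ≠ k + 2 * m) : structCoeff f k i j = 0 := by
  have h1 := weightCoeff_cartan n k (pairing f (weightVec r i) (weightVec r j))
  rw [lie_pairing, cartan_weightVec hi, cartan_weightVec hj] at h1
  simp only [map_smul, LinearMap.smul_apply, map_add, smul_eq_mul] at h1
  have hn' : (n : ℂ) + 4 * m = 2 * r := by exact_mod_cast hn
  have h2 : (((i + j : ℕ) : ℂ) - ((k + 2 * m : ℕ) : ℂ)) * structCoeff f k i j = 0 := by
    rw [structCoeff]
    push_cast
    linear_combination (-1 / 2 : ℂ) * h1 - 1 / 2 *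
      weightCoeff n k (pairing f (weightVec r i) (weightVec r j)) * hn'
  exact (mul_eq_zero.1 h2).resolve_left (sub_ne_zero.2 (by exact_mod_cast h))

/-- If the coefficient of the square of the `m`-th weight vector vanishes, the lowering relations
`(r-i) c(i+1,j) + (r-j) c(i,j+1) = 0` propagate this along `i + j = 2m`. -/
theorem structCoeff_zero_eq_zero (hm : 2 * m ≤ r) (h : structCoeff f 0 m m = 0) {t : ℕ}
    (ht : t ≤ m) : structCoeff f 0 (m + t) (m - t) = 0 := by
  induction t with
  | zero => simpa using h
  | succ t ih =>
    have h1 := structCoeff_lower_zero f (i := m + t) (j := m - (t + 1)) (by omega) (by omega)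
    rw [show m - (t + 1) + 1 = m - t by omega, ih (by omega), mul_zero, add_zero] at h1
    refine (mul_eq_zero.1 h1).resolve_left (sub_ne_zero.2 ?_)
    exact_mod_cast (show r ≠ m + t by omega)

/-- A surjective equivariant map is nonzero on the square of the `m`-th weight vector. -/
theorem structCoeff_zero_ne_zero (hn : n + 4 * m = 2 * r) (hf : Function.Surjective f) :
    structCoeff f 0 m m ≠ 0 := by
  intro h
  have hall : ∀ i j, i ≤ r → j ≤ r → structCoeff f 0 i j = 0 := by
    intro i j hi hj
    by_cases hij : i + j = 0 + 2 * m
    · rcases le_total m i with hmi | hmi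
      · have := structCoeff_zero_eq_zero f (by omega) h (t := i - m) (by omega)
        rwa [show m + (i - m) = i by omega, show m - (i - m) = j by omega] at this
      · have := structCoeff_zero_eq_zero f (by omega) h (t := j - m) (by omega)
        rwa [show m + (j - m) = j by omega, show m - (j - m) = i by omega,
          structCoeff_comm] at this
    · exact structCoeff_eq_zero f hn hi hj hij
  have hzero : weightCoeff n 0 ∘ₗ (f : SymSq (S r) →ₗ[ℂ] S n) = 0 := by
    refine symSq_linear_ext fun x y => ?_
    change weightCoeff n 0 (pairing f x y) = 0
    rw [weightCoeff_pairing]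
    refine Finset.sum_eq_zero fun i _ => Finset.sum_eq_zero fun j _ => ?_
    rw [hall i j (Nat.lt_succ_iff.1 i.2) (Nat.lt_succ_iff.1 j.2), mul_zero]
  obtain ⟨w, hw⟩ := hf (weightVec n 0)
  have h1 := LinearMap.congr_fun hzero w
  change weightCoeff n 0 (f w) = 0 at h1
  rw [hw, weightCoeff_weightVec (Nat.zero_le n), if_pos rfl] at h1
  exact one_ne_zero h1

/-- The squares of the weight vectors of index `m, …, r - m` have nonzero image. Lowering the square
of the `i`-th weight vector and raising the square of the next one both give a multiple of the
image of the product of the two, with nonzero factors. -/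
theorem structCoeff_square_ne_zero (hn : n + 4 * m = 2 * r) (hf : Function.Surjective f) {k : ℕ}
    (hk : k + 2 * m ≤ r) : structCoeff f (2 * k) (m + k) (m + k) ≠ 0 := by
  induction k with
  | zero => exact structCoeff_zero_ne_zero f hn hf
  | succ k ih =>
    intro h0
    refine ih (by omega) ?_
    have h1 := structCoeff_raise f (i := m + (k + 1)) (j := m + (k + 1)) (by omega) (by omega)
      (2 * k + 1)
    rw [show 2 * k + 1 + 1 = 2 * (k + 1) by ring, h0, mul_zero,
      show m + (k + 1) - 1 = m + k by omega, structCoeff_comm f _ (m + k), ← two_mul] at h1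
    have h2 : structCoeff f (2 * k + 1) (m + (k + 1)) (m + k) = 0 := by
      have h3 : ((m + (k + 1) : ℕ) : ℂ) ≠ 0 := by
        exact_mod_cast (show m + (k + 1) ≠ 0 by omega)
      exact (mul_eq_zero.1 ((mul_eq_zero.1 h1.symm).resolve_left two_ne_zero)).resolve_left h3
    have h4 := structCoeff_lower_succ f (i := m + k) (j := m + k) (k := 2 * k) (by omega)
      (by omega) (by omega)
    rw [structCoeff_comm f _ (m + k) (m + k + 1), show m + k + 1 = m + (k + 1) by ring, h2,
      mul_zero, add_zero] at h4
    refine (mul_eq_zero.1 h4).resolve_left (sub_ne_zero.2 ?_)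
    exact_mod_cast (show n ≠ 2 * k by omega)

/-! ### The quadrics that define `M_m` -/

/-- The `k`-th weight coordinate of `f(xx)` as a quadratic form in the weight coordinates of `x`. -/
noncomputable def quadric (k : ℕ) : MvPolynomial (Fin (r + 1)) ℂ :=
  ∑ i : Fin (r + 1), ∑ j : Fin (r + 1),
    MvPolynomial.C (structCoeff f k i j) * (MvPolynomial.X i * MvPolynomial.X j)

theorem quadric_mem_vanishing (k : ℕ) : quadric f k ∈ vanishing (weightBasis r) (M f) := by
  have h : (quadric f k).IsHomogeneous 2 :=
    MvPolynomial.IsHomogeneous.sum _ _ _ fun i _ => MvPolynomial.IsHomogeneous.sum _ _ _ fun j _ =>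
      by simpa using (MvPolynomial.isHomogeneous_C _ (structCoeff f k i j)).mul
          ((MvPolynomial.isHomogeneous_X ℂ i).mul (MvPolynomial.isHomogeneous_X ℂ j))
  rw [mem_vanishing_of_isHomogeneous _ h]
  intro x hx
  have hx : pairing f x.rep x.rep = 0 := hx
  have h1 := weightCoeff_pairing f k x.rep x.rep
  rw [hx, map_zero] at h1
  rw [h1]
  simp only [quadric, map_sum, map_mul, MvPolynomial.eval_C, MvPolynomial.eval_X, weightBasis_repr]
  exact Finset.sum_congr rfl fun i _ => Finset.sum_congr rfl fun j _ => mul_comm _ _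

/-- No point of `M_m` has all its weight coordinates of index `< m` and `> r - m` equal to zero, in
terms of primes: modulo the coordinates of index `< m + k`, the quadric of index `2k` is a nonzero
multiple of the square of the coordinate of index `m + k`, so a prime that contains the ideal of
`M_m` and the outer coordinates contains all coordinates, by induction on `k`. -/
theorem X_mem_of_vanishing_le (hn : n + 4 * m = 2 * r) (hf : Function.Surjective f)
    {Q : Ideal (MvPolynomial (Fin (r + 1)) ℂ)} (hQ : Q.IsPrime)
    (hle : vanishing (weightBasis r) (M f) ≤ Q)
    (hout : ∀ i : Fin (r + 1), ((i : ℕ) < m ∨ r < i + m) → MvPolynomial.X i ∈ Q)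
    (i : Fin (r + 1)) : MvPolynomial.X i ∈ Q := by
  obtain ⟨i, hi⟩ := i
  induction i using Nat.strong_induction_on with
  | _ i ih =>
    by_cases hmem : i < m ∨ r < i + m
    · exact hout ⟨i, hi⟩ hmem
    obtain ⟨k, rfl⟩ : ∃ k, i = m + k := ⟨i - m, by omega⟩
    have hlt : ∀ j : Fin (r + 1), (j : ℕ) < m + k → MvPolynomial.X j ∈ Q :=
      fun j hj => ih j hj j.2
    set i₀ : Fin (r + 1) := ⟨m + k, hi⟩
    have hother : ∀ i j : Fin (r + 1), (i, j) ≠ (i₀, i₀) →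
        MvPolynomial.C (structCoeff f (2 * k) i j) *
          (MvPolynomial.X i * MvPolynomial.X j) ∈ Q := by
      intro i j hij
      by_cases hsum : (i : ℕ) + j = 2 * k + 2 * m
      · rcases lt_trichotomy (i : ℕ) (m + k) with h | h | h
        · exact Q.mul_mem_left _ (Q.mul_mem_right _ (hlt i h))
        · exact absurd (Prod.ext (Fin.ext h) (Fin.ext (show (j : ℕ) = m + k by omega))) hij
        · exact Q.mul_mem_left _ (Q.mul_mem_left _ (hlt j (by omega)))
      · rw [structCoeff_eq_zero f hn (Nat.lt_succ_iff.1 i.2) (Nat.lt_succ_iff.1 j.2) hsum,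
          MvPolynomial.C_0, zero_mul]
        exact Q.zero_mem
    have hq : quadric f (2 * k) ∈ Q := hle (quadric_mem_vanishing f _)
    rw [quadric, ← Finset.sum_product', Finset.univ_product_univ,
      ← Finset.add_sum_erase _ _ (Finset.mem_univ (i₀, i₀)),
      Ideal.add_mem_iff_left _ (Q.sum_mem fun p hp => hother p.1 p.2 (Finset.ne_of_mem_erase hp))]
      at hq
    have hunit : IsUnit (MvPolynomial.C (structCoeff f (2 * k) i₀ i₀) :
        MvPolynomial (Fin (r + 1)) ℂ) :=
      (structCoeff_square_ne_zero f hn hf (by omega)).isUnit.map MvPolynomial.C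
    rw [Ideal.unit_mul_mem_iff_mem _ hunit] at hq
    exact (hQ.mem_or_mem hq).elim id id

end BinaryForms

theorem mainTheorem2 (r m : ℕ) (hm : 2 * m ≤ r)
    (f : BinaryForms.SymSq (BinaryForms.S r) →ₗ⁅ℂ, BinaryForms.SL2⁆ BinaryForms.S (2 * r - 4 * m))
    (hf : Function.Surjective f) :
    BinaryForms.zariskiDim (BinaryForms.M f) < ((2 * m : ℕ) : WithBot ℕ∞) ∧
      (m = 0 → BinaryForms.M f = ∅) := by
  -- The coordinates that cut out the span of the weight vectors of index `m, …, r - m`.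
  let T : Finset (Fin (r + 1)) := Finset.univ.filter fun i => (i : ℕ) < m ∨ r < i + m
  have hT : T.card ≤ 2 * m := by
    have hsub : T.image Fin.val ⊆ Finset.range m ∪ Finset.Ioc (r - m) r := by
      intro i hi
      simp only [T, Finset.mem_image, Finset.mem_filter, Finset.mem_univ, true_and] at hi
      obtain ⟨j, hj, rfl⟩ := hi
      rw [Finset.mem_union, Finset.mem_range, Finset.mem_Ioc]
      omega
    rw [← Finset.card_image_of_injective T Fin.val_injective]
    refine (Finset.card_le_card hsub).trans ((Finset.card_union_le _ _).trans ?_)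
    rw [Finset.card_range, Nat.card_Ioc]
    omega
  have hdim : BinaryForms.zariskiDim (BinaryForms.M f) < ((2 * m : ℕ) : WithBot ℕ∞) :=
    (BinaryForms.zariskiDim_lt_card (BinaryForms.weightBasis r) (BinaryForms.M f) T
      fun Q hQ hle hX => BinaryForms.X_mem_of_vanishing_le (m := m) f (by omega) hf hQ hle
        fun i hi => hX i (by simpa [T] using hi)).trans_le (by exact_mod_cast hT)
  refine ⟨hdim, fun h0 => BinaryForms.eq_empty_of_zariskiDim_lt_zero ?_⟩
  subst h0
  simpa using hdim
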